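/- Let $N\ge 2$, let $\Omega\subset\mathbb R^N$ be an open, bounded, connected domain of class $C^2$, and write $d(x)=\operatorname{dist}(x,\partial\Omega)$. Let $\alpha\in(0,1)$, $p>1$, and let $f:\Omega\to\mathbb R$ satisfy $f\ge 0$ and $f\in C^\beta_{loc}(\Omega)$ for some $\beta>0$. Put $$(-\Delta)^\alpha u(x)=-\frac12\int_{\mathbb R^N}\frac{u(x+y)+u(x-y)-2u(x)}{|y|^{N+2\alpha}}\,dy .$$ By a solution we mean a classical solution of $$(-\Delta)^\alpha u+|u|^{p-1}u=f\ \text{ in }\Omega,\qquad u=0\ \text{ in }\Omega^c,\qquad \lim_{x\in\Omega,\,x\to\partial\Omega}u(x)=+\infty,$$ that is, a function $u$, continuous in $\Omega$ and with $\int_{\mathbb R^N}\frac{|u(y)|}{1+|y|^{N+2\alpha}}\,dy<\infty$, such that for every $x\in\Omega$ the integral defining $(-\Delta)^\alpha u(x)$ converges absolutely and the equation holds at $x$, such that $u=0$ almost everywhere in $\Omega^c$, and such that the boundary limit holds. For a function $w$ on $\Omega$ and $\tau\in\mathbb R$ write $w\asymp d^\tau$ if $$0<\liminf_{x\in\Omega,\,x\to\partial\Omega}w(x)d(x)^{-\tau}\le\limsup_{x\in\Omega,\,x\to\partial\Omega}w(x)d(x)^{-\tau}<+\infty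 .$$ Assume $f\asymp d^\gamma$ for some $\gamma\in(-1-2\alpha,0)$. (i) (Weak source) If $-2\alpha-\frac{2\alpha}{p-1}\le\gamma<-2\alpha$, then every solution $u$ with $u\asymp d^{\gamma+2\alpha}$ is positive in $\Omega$, and any two such solutions coincide in $\Omega$. (ii) (Strong source) If $-1-2\alpha<\gamma<-2\alpha-\frac{2\alpha}{p-1}$, then every solution $u$ with $u\asymp d^{\gamma/p}$ is positive in $\Omega$, and any two such solutions coincide in $\Omega$. -/

import Mathlib

open MeasureTheory Filter Topology Set

noncomputable section

namespace FracLarge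

/-- Euclidean space `ℝ^N`. -/
abbrev E (N : ℕ) := EuclideanSpace ℝ (Fin N)

variable {N : ℕ}

/-- The boundary of `Ω` is of class `C²`: near each boundary point, `Ω` is the positivity set of a
`C²` function with nonvanishing gradient at that point (equivalently, by the implicit function
theorem, `Ω` is locally the region on one side of the graph of a `C²` function). -/
def IsC2Domain (Ω : Set (E N)) : Prop :=
  ∀ x₀ ∈ frontier Ω, ∃ (U : Set (E N)) (ρ : E N → ℝ), IsOpen U ∧ x₀ ∈ U ∧
    ContDiffOn ℝ 2 ρ U ∧ fderiv ℝ ρ x₀ ≠ 0 ∧ Ω ∩ U = {x ∈ U | 0 < ρ x}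

/-- `d(x) = dist(x, ∂Ω)`. -/
def bdryDist (Ω : Set (E N)) (x : E N) : ℝ := Metric.infDist x (frontier Ω)

/-- The filter `x ∈ Ω, x → ∂Ω`, that is `x ∈ Ω` and `d(x) → 0`. -/
def toBdry (Ω : Set (E N)) : Filter (E N) := comap (bdryDist Ω) (𝓝 0) ⊓ 𝓟 Ω

/-- The two-sided rate `0 < liminf u d^{-τ} ≤ limsup u d^{-τ} < +∞` as `x ∈ Ω, x → ∂Ω`, with
`liminf` and `limsup` taken in the extended reals. -/
def HasBdryRate (Ω : Set (E N)) (u : E N → ℝ) (τ : ℝ) : Prop :=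
  0 < liminf (fun x => ((u x * bdryDist Ω x ^ (-τ) : ℝ) : EReal)) (toBdry Ω) ∧
  limsup (fun x => ((u x * bdryDist Ω x ^ (-τ) : ℝ) : EReal)) (toBdry Ω) < ⊤

/-- `f ∈ C^β_loc(Ω)` for some `β > 0`. For exponents `β ≥ 1` the class `C^β_loc` is contained in
`C^{0,1}_loc`, so it suffices to allow `β ∈ (0, 1]`. -/
def IsLocHolder (Ω : Set (E N)) (f : E N → ℝ) : Prop :=
  ∃ β : ℝ, 0 < β ∧ β ≤ 1 ∧ ∀ K : Set (E N), IsCompact K → K ⊆ Ω →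
    ∃ C : ℝ, ∀ x ∈ K, ∀ y ∈ K, |f x - f y| ≤ C * dist x y ^ β

/-- The integrand `δ(u,x,y) / |y|^{N+2α}`, with `δ(u,x,y) = u(x+y) + u(x-y) - 2u(x)`. -/
def fracKernel (α : ℝ) (u : E N → ℝ) (x y : E N) : ℝ :=
  (u (x + y) + u (x - y) - 2 * u x) / ‖y‖ ^ ((N : ℝ) + 2 * α)

/-- `(-Δ)^α u (x)` is well defined: the defining integral converges. -/
def FracLapDefined (α : ℝ) (u : E N → ℝ) (x : E N) : Prop :=
  Integrable (fun y => fracKernel α u x y) volume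

/-- `(-Δ)^α u (x) = -1/2 ∫ δ(u,x,y) / |y|^{N+2α} dy`. -/
def fracLap (α : ℝ) (u : E N → ℝ) (x : E N) : ℝ :=
  -(1 / 2) * ∫ y, fracKernel α u x y

/-- `u ∈ L¹_ω(ℝ^N)` with the weight `ω(y) = 1 / (1 + |y|^{N+2α})`. -/
def MemL1Weight (α : ℝ) (u : E N → ℝ) : Prop :=
  Integrable (fun y => u y * (1 / (1 + ‖y‖ ^ ((N : ℝ) + 2 * α)))) volume

/-- `u` is a (classical) solution of the boundary blow-up problem
`(-Δ)^α u + |u|^{p-1} u = f` in `Ω`, `u = 0` (almost everywhere) in `Ωᶜ`,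
`u(x) → +∞` as `x ∈ Ω, x → ∂Ω`. -/
structure IsLargeSolution (α p : ℝ) (Ω : Set (E N)) (f u : E N → ℝ) : Prop where
  continuousOn : ContinuousOn u Ω
  memL1Weight : MemL1Weight α u
  fracLapDefined : ∀ x ∈ Ω, FracLapDefined α u x
  equation : ∀ x ∈ Ω, fracLap α u x + |u x| ^ (p - 1) * u x = f x
  exterior : ∀ᵐ x ∂(volume : Measure (E N)), x ∉ Ω → u x = 0
  blowUp : Tendsto u (toBdry Ω) atTop

/-- The source is weak: `f ≍ d^γ` at the boundary with `γ ∈ (-1-2α, 0)` and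
`-2α - 2α/(p-1) ≤ γ < -2α`. -/
def IsWeakSource (α p γ : ℝ) (Ω : Set (E N)) (f : E N → ℝ) : Prop :=
  (-1 - 2 * α < γ ∧ γ < 0 ∧ HasBdryRate Ω f γ) ∧
  -2 * α - 2 * α / (p - 1) ≤ γ ∧ γ < -2 * α

/-- The source is strong: `f ≍ d^γ` at the boundary with
`-1 - 2α < γ < -2α - 2α/(p-1)` (and `γ ∈ (-1-2α, 0)`). -/
def IsStrongSource (α p γ : ℝ) (Ω : Set (E N)) (f : E N → ℝ) : Prop :=
  (-1 - 2 * α < γ ∧ γ < 0 ∧ HasBdryRate Ω f γ) ∧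
  γ < -2 * α - 2 * α / (p - 1)

end FracLarge

end

open MeasureTheory Filter Topology Set

noncomputable section

namespace FracLarge

variable {N : ℕ}

/-! Uniqueness comes from optimizing a constant: equal boundary rates make `m = sup u/v` finite, and
`m > 1` is refuted by lowering it. Put `z = m v - u ≥ 0`; the equations give `(-Δ)^α z = (m-1) f +
u^p - m v^p`. Where `z` vanishes this is positive, as `m^p > m`, contradicting minimality; so `u/v`
stays below `m` on compact sets (`lt_mul_of_le_mul`). Near the boundary, if `z < η v` at `x`, a
paraboloid of height `η v(x)` and width of order `d(x)` touches `z` from below at a nearby `y`, so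
`(-Δ)^α z(y)` is at most of order `η d^(τ-2α)`. For small `η` the source term `(m-1) f ≳ d^γ` beats
this, because `γ ≤ τ - 2α` (`eventually_le_mul_sub`). Both regimes satisfy that inequality, with
equality for the weak source. -/

/-! ### Boundary distance and boundary rates. -/

lemma frontier_nonempty_of_bounded (hN : 2 ≤ N) {Ω : Set (E N)}
    (hΩb : Bornology.IsBounded Ω) (hΩne : Ω.Nonempty) : (frontier Ω).Nonempty := by
  have : Nonempty (Fin N) := ⟨⟨0, by omega⟩⟩
  rw [nonempty_frontier_iff]
  refine ⟨hΩne, ?_⟩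
  rintro rfl
  exact NormedSpace.unbounded_univ ℝ (E N) hΩb

lemma bdryDist_pos {Ω : Set (E N)} (hΩo : IsOpen Ω) (hne : (frontier Ω).Nonempty)
    {x : E N} (hx : x ∈ Ω) : 0 < bdryDist Ω x := by
  refine (isClosed_frontier.notMem_iff_infDist_pos hne).1 fun h => ?_
  exact (disjoint_frontier_iff_isOpen.2 hΩo).le_bot ⟨h, hx⟩

lemma continuous_bdryDist (Ω : Set (E N)) : Continuous (bdryDist Ω) :=
  Metric.continuous_infDist_pt _

lemma bdryDist_le_add_dist (Ω : Set (E N)) (x y : E N) :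
    bdryDist Ω x ≤ bdryDist Ω y + dist x y :=
  Metric.infDist_le_infDist_add_dist

/-- The ball misses the frontier, so the disjoint open sets `Ω` and `(closure Ω)ᶜ` cover it, and
connectedness selects the one containing `x`. -/
lemma ball_bdryDist_subset {Ω : Set (E N)} (hΩo : IsOpen Ω) (hne : (frontier Ω).Nonempty)
    {x : E N} (hx : x ∈ Ω) : Metric.ball x (bdryDist Ω x) ⊆ Ω := by
  refine (Metric.isPreconnected_ball).subset_left_of_subset_union hΩo
    (isClosed_closure (s := Ω)).isOpen_compl
    (disjoint_compl_right.mono_left subset_closure) ?_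
    ⟨x, Metric.mem_ball_self (bdryDist_pos hΩo hne hx), hx⟩
  intro y hy
  by_contra hc
  simp only [mem_union, mem_compl_iff, not_or, not_not] at hc
  have hyf : y ∈ frontier Ω := by
    rw [hΩo.frontier_eq]; exact ⟨hc.2, hc.1⟩
  have h1 : bdryDist Ω x ≤ dist x y := Metric.infDist_le_dist_of_mem hyf
  rw [Metric.mem_ball, dist_comm] at hy
  linarith

lemma isCompact_le_bdryDist {Ω : Set (E N)} (hΩo : IsOpen Ω) (hΩb : Bornology.IsBounded Ω)
    {δ : ℝ} (hδ : 0 < δ) : IsCompact {x ∈ Ω | δ ≤ bdryDist Ω x} := by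
  have h : {x ∈ Ω | δ ≤ bdryDist Ω x} = closure Ω ∩ {x | δ ≤ bdryDist Ω x} := by
    ext x
    constructor
    · rintro ⟨h1, h2⟩
      exact ⟨subset_closure h1, h2⟩
    · rintro ⟨h1, h2⟩
      refine ⟨?_, h2⟩
      by_contra hx
      have hf : x ∈ frontier Ω := by
        rw [hΩo.frontier_eq]; exact ⟨h1, hx⟩
      have : bdryDist Ω x = 0 := Metric.infDist_zero_of_mem hf
      have h3 : δ ≤ bdryDist Ω x := h2
      linarith
  rw [h]
  exact hΩb.isCompact_closure.inter_right (isClosed_le continuous_const (continuous_bdryDist Ω))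

/-- This form splits `Ω` into a boundary strip and a compact core. -/
lemma eventually_toBdry {Ω : Set (E N)} {P : E N → Prop} :
    (∀ᶠ x in toBdry Ω, P x) ↔ ∃ δ > 0, ∀ x ∈ Ω, bdryDist Ω x < δ → P x := by
  rw [toBdry, eventually_inf_principal, ((Metric.nhds_basis_ball (x := (0 : ℝ))).comap _).eventually_iff]
  refine exists_congr fun δ => and_congr_right fun _ => ?_
  refine forall_congr' fun x => ?_
  simp only [mem_preimage, Metric.mem_ball, dist_zero_right, Real.norm_eq_abs,
    abs_of_nonneg (show 0 ≤ bdryDist Ω x from Metric.infDist_nonneg)]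
  tauto

lemma exists_mem_bdryDist_lt {Ω : Set (E N)} (hne : (frontier Ω).Nonempty) {δ : ℝ} (hδ : 0 < δ) :
    ∃ x ∈ Ω, bdryDist Ω x < δ := by
  obtain ⟨y, hy⟩ := hne
  obtain ⟨x, hx, hxy⟩ := Metric.mem_closure_iff.1 (frontier_subset_closure hy) δ hδ
  refine ⟨x, hx, (Metric.infDist_le_dist_of_mem hy).trans_lt ?_⟩
  rwa [dist_comm]

lemma HasBdryRate.eventually_lower {Ω : Set (E N)} (hΩo : IsOpen Ω)
    (hne : (frontier Ω).Nonempty) {u : E N → ℝ} {τ : ℝ} (h : HasBdryRate Ω u τ) :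
    ∃ c > 0, ∀ᶠ x in toBdry Ω, c * bdryDist Ω x ^ τ ≤ u x := by
  obtain ⟨c, hc0, hc⟩ := EReal.lt_iff_exists_real_btwn.1 h.1
  refine ⟨c, by exact_mod_cast hc0, ?_⟩
  have hmem : ∀ᶠ x in toBdry Ω, x ∈ Ω := eventually_toBdry.2 ⟨1, one_pos, fun x hx _ => hx⟩
  filter_upwards [eventually_lt_of_lt_liminf hc, hmem] with x hx hxΩ
  have hd := bdryDist_pos hΩo hne hxΩ
  have hx' : c < u x * bdryDist Ω x ^ (-τ) := by exact_mod_cast hx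
  rw [Real.rpow_neg hd.le, ← div_eq_mul_inv, lt_div_iff₀ (Real.rpow_pos_of_pos hd _)] at hx'
  exact hx'.le

lemma HasBdryRate.eventually_upper {Ω : Set (E N)} (hΩo : IsOpen Ω)
    (hne : (frontier Ω).Nonempty) {u : E N → ℝ} {τ : ℝ} (h : HasBdryRate Ω u τ) :
    ∃ C > 0, ∀ᶠ x in toBdry Ω, u x ≤ C * bdryDist Ω x ^ τ := by
  obtain ⟨C, hC, -⟩ := EReal.lt_iff_exists_real_btwn.1 h.2
  refine ⟨max C 1, by positivity, ?_⟩
  have hmem : ∀ᶠ x in toBdry Ω, x ∈ Ω := eventually_toBdry.2 ⟨1, one_pos, fun x hx _ => hx⟩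
  filter_upwards [eventually_lt_of_limsup_lt hC, hmem] with x hx hxΩ
  have hd := bdryDist_pos hΩo hne hxΩ
  have hx' : u x * bdryDist Ω x ^ (-τ) < C := by exact_mod_cast hx
  rw [Real.rpow_neg hd.le, ← div_eq_mul_inv, div_lt_iff₀ (Real.rpow_pos_of_pos hd _)] at hx'
  exact hx'.le.trans (mul_le_mul_of_nonneg_right (le_max_left _ _) (Real.rpow_nonneg hd.le _))

lemma ae_comp_add_left {P : E N → Prop} (h : ∀ᵐ x, P x) (y : E N) : ∀ᵐ x, P (y + x) :=
  (measurePreserving_add_left volume y).quasiMeasurePreserving.ae h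

lemma ae_comp_sub_left {P : E N → Prop} (h : ∀ᵐ x, P x) (y : E N) : ∀ᵐ x, P (y - x) :=
  (quasiMeasurePreserving_sub_left volume y).ae h

/-! ### Sliding paraboloids and the fractional Laplacian. -/

/-- The kernel `min(8|h|², 2) / |h|^{N+2α}`, which dominates the second differences of the paraboloid
`(1 - 4|x|²)₊` at points of its support. -/
def truncKernel (N : ℕ) (α : ℝ) (h : E N) : ℝ :=
  min (8 * ‖h‖ ^ 2) 2 / ‖h‖ ^ ((N : ℝ) + 2 * α)

/-- In polar coordinates the integrand is at most `8 t^(1-2α)` near zero, integrable since `α < 1`,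
and `2 t^(-1-2α)` at infinity, integrable since `α > 0`. -/
lemma integrable_truncKernel (hN : 2 ≤ N) {α : ℝ} (hα0 : 0 < α) (hα1 : α < 1) :
    Integrable (truncKernel N α) := by
  have : Nonempty (Fin N) := ⟨⟨0, by omega⟩⟩
  have hmeas : Measurable fun t : ℝ =>
      t ^ (N - 1) • (min (8 * t ^ 2) 2 / t ^ ((N : ℝ) + 2 * α)) := by fun_prop
  have key := (integrable_fun_norm_addHaar (volume : Measure (E N))
    (f := fun t : ℝ => min (8 * t ^ 2) 2 / t ^ ((N : ℝ) + 2 * α)))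
  refine key.2 ?_
  rw [finrank_euclideanSpace_fin, ← Ioc_union_Ioi_eq_Ioi (zero_le_one (α := ℝ))]
  have hpow : ∀ t : ℝ, 0 < t → t ^ (N - 1) / t ^ ((N : ℝ) + 2 * α) = t ^ (-1 - 2 * α) := by
    intro t ht
    rw [← Real.rpow_natCast, ← Real.rpow_sub ht, Nat.cast_sub (by omega)]
    congr 1
    push_cast
    ring
  have hnn : ∀ t : ℝ, 0 < t →
      0 ≤ t ^ (N - 1) • (min (8 * t ^ 2) 2 / t ^ ((N : ℝ) + 2 * α)) := by
    intro t ht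
    rw [smul_eq_mul]
    positivity
  refine IntegrableOn.union ?_ ?_
  · have h1 : IntegrableOn (fun t : ℝ => 8 * t ^ (1 - 2 * α)) (Ioc 0 1) :=
      ((intervalIntegrable_iff_integrableOn_Ioc_of_le zero_le_one).1
        (intervalIntegral.intervalIntegrable_rpow' (by linarith))).const_mul 8
    refine Integrable.mono' h1 hmeas.aestronglyMeasurable ?_
    refine (ae_restrict_mem measurableSet_Ioc).mono fun t ht => ?_
    rw [Real.norm_of_nonneg (hnn t ht.1), smul_eq_mul]
    calc t ^ (N - 1) * (min (8 * t ^ 2) 2 / t ^ ((N : ℝ) + 2 * α))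
        = min (8 * t ^ 2) 2 * (t ^ (N - 1) / t ^ ((N : ℝ) + 2 * α)) := by ring
      _ = min (8 * t ^ 2) 2 * t ^ (-1 - 2 * α) := by rw [hpow t ht.1]
      _ ≤ 8 * t ^ 2 * t ^ (-1 - 2 * α) :=
          mul_le_mul_of_nonneg_right (min_le_left _ _) (Real.rpow_nonneg ht.1.le _)
      _ = 8 * t ^ (1 - 2 * α) := by
          rw [mul_assoc, ← Real.rpow_natCast, ← Real.rpow_add ht.1]
          congr 2
          push_cast
          ring
  · have h1 : IntegrableOn (fun t : ℝ => 2 * t ^ (-1 - 2 * α)) (Ioi 1) :=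
      (integrableOn_Ioi_rpow_of_lt (by linarith) one_pos).const_mul 2
    refine Integrable.mono' h1 hmeas.aestronglyMeasurable ?_
    refine (ae_restrict_mem measurableSet_Ioi).mono fun t ht => ?_
    have ht0 : 0 < t := one_pos.trans ht
    rw [Real.norm_of_nonneg (hnn t ht0), smul_eq_mul]
    calc t ^ (N - 1) * (min (8 * t ^ 2) 2 / t ^ ((N : ℝ) + 2 * α))
        = min (8 * t ^ 2) 2 * (t ^ (N - 1) / t ^ ((N : ℝ) + 2 * α)) := by ring
      _ = min (8 * t ^ 2) 2 * t ^ (-1 - 2 * α) := by rw [hpow t ht0]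
      _ ≤ 2 * t ^ (-1 - 2 * α) :=
          mul_le_mul_of_nonneg_right (min_le_right _ _) (Real.rpow_nonneg ht0.le _)

lemma truncKernel_nonneg (α : ℝ) (h : E N) : 0 ≤ truncKernel N α h := by
  unfold truncKernel; positivity

lemma truncKernel_inv_smul {α r : ℝ} (hr : 0 < r) (h : E N) :
    truncKernel N α (r⁻¹ • h) =
      r ^ ((N : ℝ) + 2 * α) * (min (8 * (‖h‖ / r) ^ 2) 2 / ‖h‖ ^ ((N : ℝ) + 2 * α)) := by
  have hn : ‖r⁻¹ • h‖ = ‖h‖ / r := by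
    rw [norm_smul, norm_inv, Real.norm_of_nonneg hr.le, inv_mul_eq_div]
  rw [truncKernel, hn, Real.div_rpow (norm_nonneg _) hr.le, div_div_eq_mul_div]
  ring

/-- A function whose second differences at `y` are bounded below by those of a paraboloid of height
`A` and width `r` has fractional Laplacian at most of order `A r^{-2α}` there. -/
lemma fracLap_le_of_secondDiff_ge (hN : 2 ≤ N) {α : ℝ} (hα0 : 0 < α) (hα1 : α < 1)
    {z : E N → ℝ} {y : E N} {r A : ℝ} (hr : 0 < r) (hz : FracLapDefined α z y)
    (hd : ∀ᵐ h, -(A * min (8 * (‖h‖ / r) ^ 2) 2) ≤ z (y + h) + z (y - h) - 2 * z y) :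
    fracLap α z y ≤ A * r ^ (-(2 * α)) * ((1 / 2) * ∫ h, truncKernel N α h) := by
  set s : ℝ := (N : ℝ) + 2 * α with hs
  have hint : Integrable fun h : E N => truncKernel N α (r⁻¹ • h) :=
    (integrable_comp_smul_iff volume _ (inv_ne_zero hr.ne')).2 (integrable_truncKernel hN hα0 hα1)
  have hval : ∫ h : E N, truncKernel N α (r⁻¹ • h) = r ^ N * ∫ h, truncKernel N α h := by
    rw [Measure.integral_comp_inv_smul, finrank_euclideanSpace_fin, abs_of_pos (pow_pos hr N),
      smul_eq_mul]
  have hrs : 0 < r ^ s := Real.rpow_pos_of_pos hr _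
  have hle : ∫ h : E N, -(A / r ^ s) * truncKernel N α (r⁻¹ • h) ≤ ∫ h, fracKernel α z y h := by
    refine integral_mono_ae (hint.const_mul _) hz ?_
    filter_upwards [hd] with h hh
    rw [truncKernel_inv_smul hr, fracKernel, ← hs]
    have : -(A / r ^ s) * (r ^ s * (min (8 * (‖h‖ / r) ^ 2) 2 / ‖h‖ ^ s)) =
        -(A * min (8 * (‖h‖ / r) ^ 2) 2) / ‖h‖ ^ s := by
      field_simp
    rw [this]
    exact div_le_div_of_nonneg_right hh (Real.rpow_nonneg (norm_nonneg _) _)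
  rw [integral_const_mul, hval] at hle
  -- The Jacobian `r^N` against the kernel's homogeneity `r^(N+2α)` leaves the factor `r^(-2α)`.
  have hpow : r ^ N = r ^ s * r ^ (-(2 * α)) := by
    rw [← Real.rpow_add hr, ← Real.rpow_natCast, hs]
    congr 1
    ring
  rw [hpow] at hle
  have : -(A / r ^ s) * (r ^ s * r ^ (-(2 * α)) * ∫ h, truncKernel N α h) =
      -(A * r ^ (-(2 * α)) * ∫ h, truncKernel N α h) := by
    field_simp
  rw [this] at hle
  rw [fracLap]
  linarith

/-- Sliding a paraboloid of height `A` and radius `r / 2` centred at `x` below a nonnegative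
function with `z x < A` touches its graph at an interior point of the ball. -/
lemma exists_touching_paraboloid {z : E N → ℝ} {x : E N} {r A : ℝ} (hr : 0 < r)
    (hzc : ContinuousOn z (Metric.closedBall x (r / 2)))
    (hz0 : ∀ w ∈ Metric.closedBall x (r / 2), 0 ≤ z w) (hz : ∀ᵐ w, 0 ≤ z w) (hA : z x < A) :
    ∃ y ∈ Metric.ball x (r / 2), z y < A ∧
      ∀ᵐ h, -(A * min (8 * (‖h‖ / r) ^ 2) 2) ≤ z (y + h) + z (y - h) - 2 * z y := by
  have hxm : x ∈ Metric.closedBall x (r / 2) := Metric.mem_closedBall_self (by positivity)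
  have hA0 : 0 < A := (hz0 x hxm).trans_lt hA
  set φ : E N → ℝ := fun w => max 0 (1 - 4 * (‖w - x‖ / r) ^ 2) with hφ
  have hφc : Continuous φ := by fun_prop
  have hφ1 : ∀ w, φ w ≤ 1 := fun w => max_le zero_le_one (by nlinarith [sq_nonneg (‖w - x‖ / r)])
  have hφ0 : ∀ w, 0 ≤ φ w := fun w => le_max_left _ _
  -- The minimum of `z - A φ` is negative, as its value at `x` is. Hence `φ y > 0` and `y` is
  -- interior; since `φ = 0` and `z ≥ 0` a.e. outside the ball, the minimum is global up to a null
  -- set.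
  obtain ⟨y, hy, hmin⟩ := (isCompact_closedBall x (r / 2)).exists_isMinOn ⟨x, hxm⟩
    (hzc.sub (hφc.const_smul A).continuousOn)
  have hφx : φ x = 1 := by simp [hφ]
  have hyneg : z y - A * φ y < 0 := by
    have h1 : z y - A * φ y ≤ z x - A * φ x := hmin hxm
    rw [hφx] at h1
    linarith
  have hzy := hz0 y hy
  have hφy : 0 < φ y := by
    by_contra hc
    nlinarith [hφ0 y]
  have hφy' : φ y = 1 - 4 * (‖y - x‖ / r) ^ 2 := by
    refine max_eq_right (le_of_lt ?_)
    by_contra hc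
    exact hφy.ne' (max_eq_left (not_lt.1 hc))
  have hyb : y ∈ Metric.ball x (r / 2) := by
    rw [hφy'] at hφy
    rw [Metric.mem_ball, dist_eq_norm]
    have : ‖y - x‖ / r < 1 / 2 := by
      by_contra hc
      nlinarith [not_lt.1 hc]
    rw [div_lt_iff₀ hr] at this
    linarith
  have hout : ∀ w ∉ Metric.closedBall x (r / 2), φ w = 0 := by
    intro w hw
    rw [Metric.mem_closedBall, dist_eq_norm, not_le] at hw
    refine max_eq_left ?_
    have : 1 / 2 < ‖w - x‖ / r := by rw [lt_div_iff₀ hr]; linarith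
    nlinarith
  have hge : ∀ᵐ w, z y - A * φ y ≤ z w - A * φ w := by
    filter_upwards [hz] with w hw
    by_cases hwb : w ∈ Metric.closedBall x (r / 2)
    · exact hmin hwb
    · rw [hout w hwb]
      linarith
  refine ⟨y, hyb, by nlinarith [hφ1 y], ?_⟩
  filter_upwards [ae_comp_add_left hge y, ae_comp_sub_left hge y] with h h1 h2
  -- The quadratic bound is the parallelogram law, the truncation only raising `φ` at `y ± h`; the
  -- bound `2` is just `0 ≤ φ ≤ 1`.
  have hδ : -(min (8 * (‖h‖ / r) ^ 2) 2) ≤ φ (y + h) + φ (y - h) - 2 * φ y := by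
    rcases le_total (8 * (‖h‖ / r) ^ 2) 2 with hc | hc
    · rw [min_eq_left hc, hφy']
      have h3 : 1 - 4 * (‖y + h - x‖ / r) ^ 2 ≤ φ (y + h) := le_max_right _ _
      have h4 : 1 - 4 * (‖y - h - x‖ / r) ^ 2 ≤ φ (y - h) := le_max_right _ _
      have hpar := parallelogram_law_with_norm ℝ (y - x) h
      rw [show y - x + h = y + h - x by abel, show y - x - h = y - h - x by abel] at hpar
      have hpar' : (‖y + h - x‖ / r) ^ 2 + (‖y - h - x‖ / r) ^ 2 =
          2 * ((‖y - x‖ / r) ^ 2 + (‖h‖ / r) ^ 2) := by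
        simp only [div_pow, ← add_div]
        rw [hpar, mul_div_assoc]
      linarith
    · rw [min_eq_right hc]
      linarith [hφ0 (y + h), hφ0 (y - h), hφ1 y]
  nlinarith

/-! ### Positivity and comparison of large solutions. -/

namespace IsLargeSolution

variable {α p : ℝ} {Ω : Set (E N)} {f u v : E N → ℝ}

/-- Large solutions with nonnegative source are positive: at a nonpositive minimum, the equation
would force `u` to be constant almost everywhere. -/
lemma pos (hΩo : IsOpen Ω) (hΩb : Bornology.IsBounded Ω) (hne : (frontier Ω).Nonempty)
    (hf0 : ∀ x ∈ Ω, 0 ≤ f x) (hu : IsLargeSolution α p Ω f u) {x : E N} (hx : x ∈ Ω) :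
    0 < u x := by
  by_contra hneg
  rw [not_lt] at hneg
  obtain ⟨δ, hδ, hblow⟩ := eventually_toBdry.1 (hu.blowUp.eventually_gt_atTop 0)
  have hδx : δ ≤ bdryDist Ω x := by
    by_contra hc
    exact (hblow x hx (not_le.1 hc)).not_ge hneg
  obtain ⟨y, ⟨hyΩ, -⟩, hmin⟩ := (isCompact_le_bdryDist hΩo hΩb hδ).exists_isMinOn ⟨x, hx, hδx⟩
    (hu.continuousOn.mono fun w hw => hw.1)
  have hy0 : u y ≤ 0 := (hmin (show x ∈ _ from ⟨hx, hδx⟩)).trans hneg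
  have hge : ∀ᵐ w, u y ≤ u w := by
    filter_upwards [hu.exterior] with w hw
    by_cases hwΩ : w ∈ Ω
    · rcases le_or_gt δ (bdryDist Ω w) with hd | hd
      · exact hmin (show w ∈ _ from ⟨hwΩ, hd⟩)
      · exact hy0.trans (hblow w hwΩ hd).le
    · rw [hw hwΩ]
      exact hy0
  have hk0 : 0 ≤ᵐ[volume] fun h => fracKernel α u y h := by
    filter_upwards [ae_comp_add_left hge y, ae_comp_sub_left hge y] with h h1 h2
    exact div_nonneg (by linarith) (Real.rpow_nonneg (norm_nonneg _) _)
  have hlap : 0 ≤ fracLap α u y := by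
    have h1 := hu.equation y hyΩ
    have h2 := hf0 y hyΩ
    have h3 : |u y| ^ (p - 1) * u y ≤ 0 :=
      mul_nonpos_of_nonneg_of_nonpos (Real.rpow_nonneg (abs_nonneg _) _) hy0
    linarith
  have hint : ∫ h, fracKernel α u y h = 0 := by
    have h1 := integral_nonneg_of_ae hk0
    rw [fracLap] at hlap
    linarith
  have hconst : ∀ᵐ h, u (y + h) = u y := by
    filter_upwards [ae_comp_add_left hge y, ae_comp_sub_left hge y,
      (integral_eq_zero_iff_of_nonneg_ae hk0 (hu.fracLapDefined y hyΩ)).1 hint] with h h1 h2 h3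
    rcases eq_or_ne h 0 with rfl | hh
    · rw [add_zero]
    · rcases div_eq_zero_iff.1 h3 with h4 | h4
      · linarith
      · exact absurd h4 (Real.rpow_pos_of_pos (norm_pos_iff.2 hh) _).ne'
  have hconst' : ∀ᵐ w, u w = u y := by
    filter_upwards [ae_comp_add_left hconst (-y)] with w hw
    simpa using hw
  -- The strip where `u > 0` is open and nonempty, so it has positive measure and `u` cannot equal
  -- `u y ≤ 0` almost everywhere.
  have hopen : IsOpen (Ω ∩ {w | bdryDist Ω w < δ}) :=
    hΩo.inter (isOpen_lt (continuous_bdryDist Ω) continuous_const)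
  obtain ⟨w, hw, hwδ⟩ := exists_mem_bdryDist_lt hne hδ
  refine (hopen.measure_pos volume ⟨w, hw, hwδ⟩).ne' (measure_mono_null ?_ hconst')
  intro w' hw' heq
  have := hblow w' hw'.1 hw'.2
  rw [heq] at this
  linarith

lemma fracLap_eq (hu : IsLargeSolution α p Ω f u) {x : E N} (hx : x ∈ Ω) (h0 : 0 < u x) :
    fracLap α u x = f x - u x ^ p := by
  have h := hu.equation x hx
  rw [abs_of_pos h0, ← Real.rpow_add_one h0.ne', sub_add_cancel] at h
  linarith

lemma fracKernel_mul_sub (m : ℝ) (x h : E N) :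
    fracKernel α (fun w => m * v w - u w) x h = m * fracKernel α v x h - fracKernel α u x h := by
  simp only [fracKernel]
  ring

lemma fracLapDefined_mul_sub (hu : IsLargeSolution α p Ω f u) (hv : IsLargeSolution α p Ω f v)
    (m : ℝ) {x : E N} (hx : x ∈ Ω) : FracLapDefined α (fun w => m * v w - u w) x := by
  simp only [FracLapDefined, fracKernel_mul_sub]
  exact ((hv.fracLapDefined x hx).const_mul m).sub (hu.fracLapDefined x hx)

lemma fracLap_mul_sub (hu : IsLargeSolution α p Ω f u) (hv : IsLargeSolution α p Ω f v)
    (m : ℝ) {x : E N} (hx : x ∈ Ω) (hu0 : 0 < u x) (hv0 : 0 < v x) :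
    fracLap α (fun w => m * v w - u w) x = (m - 1) * f x + (u x ^ p - m * v x ^ p) := by
  have h1 := hu.fracLap_eq hx hu0
  have h2 := hv.fracLap_eq hx hv0
  have h3 : fracLap α (fun w => m * v w - u w) x = m * fracLap α v x - fracLap α u x := by
    simp only [fracLap, fracKernel_mul_sub]
    rw [integral_sub ((hv.fracLapDefined x hx).const_mul m) (hu.fracLapDefined x hx),
      integral_const_mul]
    ring
  rw [h3, h1, h2]
  ring

lemma ae_mul_sub_nonneg (hu : IsLargeSolution α p Ω f u) (hv : IsLargeSolution α p Ω f v)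
    {m : ℝ} (hm : ∀ x ∈ Ω, u x ≤ m * v x) : ∀ᵐ w, 0 ≤ m * v w - u w := by
  filter_upwards [hu.exterior, hv.exterior] with w h1 h2
  by_cases hw : w ∈ Ω
  · linarith [hm w hw]
  · rw [h1 hw, h2 hw]
    simp

/-- If `u ≤ m v` with `m > 1`, then the inequality is strict inside `Ω`. -/
lemma lt_mul_of_le_mul (hp : 1 < p) (hf0 : ∀ x ∈ Ω, 0 ≤ f x)
    (hu : IsLargeSolution α p Ω f u) (hv : IsLargeSolution α p Ω f v)
    (hu0 : ∀ x ∈ Ω, 0 < u x) (hv0 : ∀ x ∈ Ω, 0 < v x)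
    {m : ℝ} (hm1 : 1 < m) (hm : ∀ x ∈ Ω, u x ≤ m * v x) {x : E N} (hx : x ∈ Ω) :
    u x < m * v x := by
  refine lt_of_le_of_ne (hm x hx) fun heq => ?_
  have hz := hu.ae_mul_sub_nonneg hv hm
  have hlap : fracLap α (fun w => m * v w - u w) x ≤ 0 := by
    have : 0 ≤ ∫ h, fracKernel α (fun w => m * v w - u w) x h := by
      refine integral_nonneg_of_ae ?_
      filter_upwards [ae_comp_add_left hz x, ae_comp_sub_left hz x] with h h1 h2
      exact div_nonneg (by linarith) (Real.rpow_nonneg (norm_nonneg _) _)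
    rw [fracLap]
    linarith
  rw [hu.fracLap_mul_sub hv m hx (hu0 x hx) (hv0 x hx), heq,
    Real.mul_rpow (by linarith) (hv0 x hx).le] at hlap
  have h1 : 0 ≤ (m - 1) * f x := mul_nonneg (by linarith) (hf0 x hx)
  have h2 : m < m ^ p := Real.self_lt_rpow_of_one_lt hm1 hp
  have h3 : 0 < v x ^ p := Real.rpow_pos_of_pos (hv0 x hx) _
  nlinarith [mul_pos (sub_pos.2 h2) h3]

/-- If `u ≤ m v` with `m > 1`, then the constant can be improved near the boundary. -/
lemma eventually_le_mul_sub (hN : 2 ≤ N) (hΩo : IsOpen Ω) (hne : (frontier Ω).Nonempty)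
    (hα0 : 0 < α) (hα1 : α < 1) (hp : 1 < p) {γ τ : ℝ} (hγ : γ ≤ 0) (hτ : τ ≤ 0)
    (hγτ : γ ≤ τ - 2 * α) (hfγ : HasBdryRate Ω f γ)
    (hu : IsLargeSolution α p Ω f u) (hv : IsLargeSolution α p Ω f v)
    (hu0 : ∀ x ∈ Ω, 0 < u x) (hv0 : ∀ x ∈ Ω, 0 < v x) (hvτ : HasBdryRate Ω v τ)
    {m : ℝ} (hm1 : 1 < m) (hm : ∀ x ∈ Ω, u x ≤ m * v x) :
    ∃ η > 0, ∀ᶠ x in toBdry Ω, u x ≤ (m - η) * v x := by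
  have hm0 : 0 < m := one_pos.trans hm1
  obtain ⟨c, hc, hfl⟩ := hfγ.eventually_lower hΩo hne
  obtain ⟨c₁, hc₁, hvl⟩ := hvτ.eventually_lower hΩo hne
  obtain ⟨C₁, hC₁, hvu⟩ := hvτ.eventually_upper hΩo hne
  obtain ⟨ε, hε, hev⟩ := eventually_toBdry.1 (hfl.and (hvl.and hvu))
  set K : ℝ := (1 / 2) * ∫ h, truncKernel N α h with hK
  have hK0 : 0 ≤ K := mul_nonneg (by norm_num) (integral_nonneg (truncKernel_nonneg α))
  -- `B` is a Harnack-type constant: `v x ≤ B * v y` at the touching point, where `d(y) ≤ 3d(x)/2`.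
  set B : ℝ := C₁ / (c₁ * (3 / 2 : ℝ) ^ τ) with hB
  have hB0 : 0 < B := by positivity
  set D : ℝ := (m - 1) * (c * (3 / 2 : ℝ) ^ γ) with hD
  have hD0 : 0 < D := mul_pos (by linarith) (by positivity)
  have hroot : m ^ p⁻¹ < m :=
    (Real.rpow_lt_rpow_of_exponent_lt hm1 (inv_lt_one_of_one_lt₀ hp)).trans_eq (Real.rpow_one m)
  -- The first bound forces `u ≥ m^(1/p) v` at the touching point, so that `u^p - m v^p ≥ 0` there;
  -- the second keeps the paraboloid's contribution below the source term.
  set η : ℝ := min ((m - m ^ p⁻¹) / B) (D / (C₁ * K + 1)) with hη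
  have hη0 : 0 < η := lt_min (div_pos (by linarith) hB0) (by positivity)
  have hηB : η * B ≤ m - m ^ p⁻¹ := (le_div_iff₀ hB0).1 (min_le_left _ _)
  have hηD : η * (C₁ * K) < D := by
    have := (le_div_iff₀ (by positivity : 0 < C₁ * K + 1)).1 (min_le_right _ _ : η ≤ _)
    linarith
  -- `ε / 2` keeps the touching point in the strip where the rates hold; `d < 1` allows exponents to
  -- be compared.
  refine ⟨η, hη0, eventually_toBdry.2 ⟨min (ε / 2) 1, by positivity, fun x hx hxd => ?_⟩⟩
  by_contra hcon
  rw [not_le] at hcon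
  set d := bdryDist Ω x with hd
  have hd0 : 0 < d := bdryDist_pos hΩo hne hx
  have hdε : d < ε / 2 := hxd.trans_le (min_le_left _ _)
  have hd1 : d < 1 := hxd.trans_le (min_le_right _ _)
  have hsub : Metric.closedBall x (d / 2) ⊆ Ω :=
    (Metric.closedBall_subset_ball (by linarith)).trans (ball_bdryDist_subset hΩo hne hx)
  obtain ⟨y, hy, hzy, hydiff⟩ := exists_touching_paraboloid (z := fun w => m * v w - u w)
    (x := x) (r := d) (A := η * v x) hd0
    (((hv.continuousOn.const_smul m).sub hu.continuousOn).mono hsub)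
    (fun w hw => by linarith [hm w (hsub hw)]) (hu.ae_mul_sub_nonneg hv hm)
    (by linarith)
  have hyΩ : y ∈ Ω := hsub (Metric.ball_subset_closedBall hy)
  have hlap := fracLap_le_of_secondDiff_ge hN hα0 hα1 hd0
    (hu.fracLapDefined_mul_sub hv m hyΩ) hydiff
  rw [hu.fracLap_mul_sub hv m hyΩ (hu0 y hyΩ) (hv0 y hyΩ), ← hK] at hlap
  have hdy0 : 0 < bdryDist Ω y := bdryDist_pos hΩo hne hyΩ
  have hdy : bdryDist Ω y ≤ 3 / 2 * d := by
    have h1 := bdryDist_le_add_dist Ω y x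
    rw [Metric.mem_ball] at hy
    linarith
  obtain ⟨-, -, hvx⟩ := hev x hx (by linarith)
  obtain ⟨hfy, hvy, -⟩ := hev y hyΩ (by linarith)
  -- As `γ` and `τ` are nonpositive, an upper bound on `d(y)` suffices.
  have hpow : ∀ σ ≤ (0 : ℝ), (3 / 2 : ℝ) ^ σ * d ^ σ ≤ bdryDist Ω y ^ σ := by
    intro σ hσ
    rw [← Real.mul_rpow (by norm_num) hd0.le]
    exact Real.rpow_le_rpow_of_nonpos hdy0 hdy hσ
  have hvxy : v x ≤ B * v y := by
    have h1 : c₁ * ((3 / 2 : ℝ) ^ τ * d ^ τ) ≤ v y :=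
      (mul_le_mul_of_nonneg_left (hpow τ hτ) hc₁.le).trans hvy
    calc v x ≤ C₁ * d ^ τ := hvx
      _ = B * (c₁ * ((3 / 2 : ℝ) ^ τ * d ^ τ)) := by
          rw [hB]
          field_simp
      _ ≤ B * v y := mul_le_mul_of_nonneg_left h1 hB0.le
  have hvy0 := hv0 y hyΩ
  have huv : m ^ p⁻¹ * v y ≤ u y := by
    have h1 : η * v x ≤ η * B * v y := by
      rw [mul_assoc]
      exact mul_le_mul_of_nonneg_left hvxy hη0.le
    have h2 : η * B * v y ≤ (m - m ^ p⁻¹) * v y := mul_le_mul_of_nonneg_right hηB hvy0.le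
    linarith
  have hup : m * v y ^ p ≤ u y ^ p := by
    have h1 := Real.rpow_le_rpow (by positivity) huv (by linarith : 0 ≤ p)
    rwa [Real.mul_rpow (by positivity) hvy0.le, Real.rpow_inv_rpow hm0.le (by linarith)] at h1
  have hlow : D * d ^ γ ≤ (m - 1) * f y := by
    have h1 : c * ((3 / 2 : ℝ) ^ γ * d ^ γ) ≤ f y :=
      (mul_le_mul_of_nonneg_left (hpow γ hγ) hc.le).trans hfy
    have h2 := mul_le_mul_of_nonneg_left h1 (by linarith : 0 ≤ m - 1)
    linarith
  have hupp : η * v x * d ^ (-(2 * α)) * K ≤ η * (C₁ * K) * d ^ γ := by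
    have h1 : v x * d ^ (-(2 * α)) ≤ C₁ * d ^ γ := by
      calc v x * d ^ (-(2 * α)) ≤ C₁ * d ^ τ * d ^ (-(2 * α)) :=
            mul_le_mul_of_nonneg_right hvx (by positivity)
        _ = C₁ * d ^ (τ - 2 * α) := by
            rw [mul_assoc, ← Real.rpow_add hd0, ← sub_eq_add_neg]
        _ ≤ C₁ * d ^ γ := mul_le_mul_of_nonneg_left
            (Real.rpow_le_rpow_of_exponent_ge hd0 hd1.le hγτ) hC₁.le
    calc η * v x * d ^ (-(2 * α)) * K = η * K * (v x * d ^ (-(2 * α))) := by ring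
      _ ≤ η * K * (C₁ * d ^ γ) := mul_le_mul_of_nonneg_left h1 (by positivity)
      _ = η * (C₁ * K) * d ^ γ := by ring
  have hdγ : 0 < d ^ γ := Real.rpow_pos_of_pos hd0 _
  have := mul_lt_mul_of_pos_right hηD hdγ
  linarith

/-- Comparison of large solutions with the same boundary rate `τ`, when the source is at least of
order `d ^ (τ - 2α)`. -/
lemma le_of_hasBdryRate (hN : 2 ≤ N) (hΩo : IsOpen Ω) (hΩb : Bornology.IsBounded Ω)
    (hne : (frontier Ω).Nonempty) (hα0 : 0 < α) (hα1 : α < 1) (hp : 1 < p)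
    (hf0 : ∀ x ∈ Ω, 0 ≤ f x) {γ τ : ℝ} (hγ : γ ≤ 0) (hτ : τ ≤ 0)
    (hγτ : γ ≤ τ - 2 * α) (hfγ : HasBdryRate Ω f γ)
    (hu : IsLargeSolution α p Ω f u) (huτ : HasBdryRate Ω u τ)
    (hv : IsLargeSolution α p Ω f v) (hvτ : HasBdryRate Ω v τ) {x : E N} (hx : x ∈ Ω) :
    u x ≤ v x := by
  have hu0 : ∀ x ∈ Ω, 0 < u x := fun x hx => hu.pos hΩo hΩb hne hf0 hx
  have hv0 : ∀ x ∈ Ω, 0 < v x := fun x hx => hv.pos hΩo hΩb hne hf0 hx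
  have hcont : ContinuousOn (fun x => u x / v x) Ω :=
    hu.continuousOn.div hv.continuousOn fun x hx => (hv0 x hx).ne'
  have hcompact : ∀ {δ : ℝ}, 0 < δ → BddAbove ((fun x => u x / v x) '' {x ∈ Ω | δ ≤ bdryDist Ω x}) :=
    fun hδ => (isCompact_le_bdryDist hΩo hΩb hδ).bddAbove_image (hcont.mono fun w hw => hw.1)
  have hbdd : BddAbove ((fun x => u x / v x) '' Ω) := by
    obtain ⟨c, hc, hvl⟩ := hvτ.eventually_lower hΩo hne
    obtain ⟨C, hC, huu⟩ := huτ.eventually_upper hΩo hne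
    obtain ⟨δ, hδ, hev⟩ := eventually_toBdry.1 (hvl.and huu)
    obtain ⟨M, hM⟩ := hcompact hδ
    refine ⟨max M (C / c), ?_⟩
    rintro _ ⟨w, hw, rfl⟩
    rcases le_or_gt δ (bdryDist Ω w) with hd | hd
    · exact (hM ⟨w, ⟨hw, hd⟩, rfl⟩).trans (le_max_left _ _)
    · refine le_trans ?_ (le_max_right _ _)
      obtain ⟨h1, h2⟩ := hev w hw hd
      rw [div_le_div_iff₀ (hv0 w hw) hc]
      calc u w * c ≤ C * bdryDist Ω w ^ τ * c := mul_le_mul_of_nonneg_right h2 hc.le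
        _ = C * (c * bdryDist Ω w ^ τ) := by ring
        _ ≤ C * v w := mul_le_mul_of_nonneg_left h1 hC.le
  set m := sSup ((fun x => u x / v x) '' Ω) with hmdef
  have hm : ∀ w ∈ Ω, u w ≤ m * v w := fun w hw =>
    (div_le_iff₀ (hv0 w hw)).1 (le_csSup hbdd ⟨w, hw, rfl⟩)
  rcases le_or_gt m 1 with hm1 | hm1
  · exact (hm x hx).trans (mul_le_of_le_one_left (hv0 x hx).le hm1)
  · exfalso
    obtain ⟨η, hη, hevη⟩ := hu.eventually_le_mul_sub hN hΩo hne hα0 hα1 hp hγ hτ hγτ hfγ hv hu0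
      hv0 hvτ hm1 hm
    obtain ⟨δ, hδ, hev⟩ := eventually_toBdry.1 hevη
    -- On the compact core the maximum of `u/v` is attained, hence below `m`. An empty core admits
    -- any `m' < m`.
    have hlt : ∃ m' < m, ∀ w ∈ {x ∈ Ω | δ ≤ bdryDist Ω x}, u w / v w ≤ m' := by
      rcases ({x ∈ Ω | δ ≤ bdryDist Ω x}).eq_empty_or_nonempty with he | hnon
      · exact ⟨m - 1, by linarith, by simp [he]⟩
      · obtain ⟨y, hy, hmax⟩ := (isCompact_le_bdryDist hΩo hΩb hδ).exists_isMaxOn hnon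
          (hcont.mono fun w hw => hw.1)
        refine ⟨u y / v y, ?_, fun w hw => hmax hw⟩
        rw [div_lt_iff₀ (hv0 y hy.1)]
        exact hu.lt_mul_of_le_mul hp hf0 hv hu0 hv0 hm1 hm hy.1
    obtain ⟨m', hm', hK⟩ := hlt
    have hle : m ≤ max m' (m - η) := by
      refine csSup_le ⟨_, x, hx, rfl⟩ ?_
      rintro _ ⟨w, hw, rfl⟩
      rcases le_or_gt δ (bdryDist Ω w) with hd | hd
      · exact (hK w ⟨hw, hd⟩).trans (le_max_left _ _)
      · exact ((div_le_iff₀ (hv0 w hw)).2 (hev w hw hd)).trans (le_max_right _ _)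
    exact hle.not_gt (max_lt hm' (by linarith))

end IsLargeSolution

/-- This supplies `γ ≤ τ - 2α` for `τ = γ/p`; it is the strong-source condition `γ (p-1) < -2αp`
divided by `p`. -/
lemma IsStrongSource.lt_div_sub {α p γ : ℝ} {Ω : Set (E N)} {f : E N → ℝ} (hp : 1 < p)
    (h : IsStrongSource α p γ Ω f) : γ < γ / p - 2 * α := by
  have hp1 : 0 < p - 1 := by linarith
  have h1 := h.2
  have h2 : -2 * α - 2 * α / (p - 1) = -(2 * α * p) / (p - 1) := by
    field_simp
    ring
  rw [h2, lt_div_iff₀ hp1] at h1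
  rw [lt_sub_iff_add_lt, lt_div_iff₀ (by linarith)]
  linarith

end FracLarge

end

theorem theorem1p3 {N : ℕ} (hN : 2 ≤ N) {Ω : Set (FracLarge.E N)}
    (hΩo : IsOpen Ω) (hΩb : Bornology.IsBounded Ω) (hΩc : IsConnected Ω)
    (hΩ2 : FracLarge.IsC2Domain Ω)
    {α p γ : ℝ} (hα0 : 0 < α) (hα1 : α < 1) (hp : 1 < p)
    {f : FracLarge.E N → ℝ} (hf : FracLarge.IsLocHolder Ω f) (hf0 : ∀ x ∈ Ω, 0 ≤ f x) :
    (FracLarge.IsWeakSource α p γ Ω f →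
      (∀ u : FracLarge.E N → ℝ, FracLarge.IsLargeSolution α p Ω f u →
        FracLarge.HasBdryRate Ω u (γ + 2 * α) → ∀ x ∈ Ω, 0 < u x) ∧
      (∀ u v : FracLarge.E N → ℝ,
        FracLarge.IsLargeSolution α p Ω f u → FracLarge.HasBdryRate Ω u (γ + 2 * α) →
        FracLarge.IsLargeSolution α p Ω f v → FracLarge.HasBdryRate Ω v (γ + 2 * α) →
        ∀ x ∈ Ω, u x = v x)) ∧
    (FracLarge.IsStrongSource α p γ Ω f →
      (∀ u : FracLarge.E N → ℝ, FracLarge.IsLargeSolution α p Ω f u →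
        FracLarge.HasBdryRate Ω u (γ / p) → ∀ x ∈ Ω, 0 < u x) ∧
      (∀ u v : FracLarge.E N → ℝ,
        FracLarge.IsLargeSolution α p Ω f u → FracLarge.HasBdryRate Ω u (γ / p) →
        FracLarge.IsLargeSolution α p Ω f v → FracLarge.HasBdryRate Ω v (γ / p) →
        ∀ x ∈ Ω, u x = v x)) := by
  have hne := FracLarge.frontier_nonempty_of_bounded hN hΩb hΩc.nonempty
  refine ⟨fun h => ⟨fun u hu _ x hx => hu.pos hΩo hΩb hne hf0 hx,
      fun u v hu huτ hv hvτ x hx => ?_⟩,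
    fun h => ⟨fun u hu _ x hx => hu.pos hΩo hΩb hne hf0 hx,
      fun u v hu huτ hv hvτ x hx => ?_⟩⟩
  · obtain ⟨⟨-, hγ, hfγ⟩, -, hγα⟩ := h
    have hτ : γ + 2 * α ≤ 0 := by linarith
    exact le_antisymm
      (hu.le_of_hasBdryRate hN hΩo hΩb hne hα0 hα1 hp hf0 hγ.le hτ (by linarith) hfγ huτ hv hvτ hx)
      (hv.le_of_hasBdryRate hN hΩo hΩb hne hα0 hα1 hp hf0 hγ.le hτ (by linarith) hfγ hvτ hu huτ hx)
  · have hγτ := (h.lt_div_sub hp).le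
    obtain ⟨⟨-, hγ, hfγ⟩, -⟩ := h
    have hτ : γ / p ≤ 0 := div_nonpos_of_nonpos_of_nonneg hγ.le (by linarith)
    exact le_antisymm
      (hu.le_of_hasBdryRate hN hΩo hΩb hne hα0 hα1 hp hf0 hγ.le hτ hγτ hfγ huτ hv hvτ hx)
      (hv.le_of_hasBdryRate hN hΩo hΩb hne hα0 hα1 hp hf0 hγ.le hτ hγτ hfγ hvτ hu huτ hx)
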